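/- Let $n\ge 4$ be an integer with exactly $k$ distinct prime divisors, and let $p<q$ be two primes dividing $n$. Let $\mathrm{ICG}_n(\{p,q\})$ be the integral circulant graph with vertex set $\mathbb{Z}/n\mathbb{Z}$ in which two vertices are adjacent if and only if their difference is the residue class of an integer $m$ with $1\le m<n$ and $\gcd(m,n)\in\{p,q\}$. Let $E$ be its energy, i.e. the sum of the absolute values of the eigenvalues (with multiplicity) of its adjacency matrix, and let $\varphi$ denote Euler's totient function. Write $r\,\|\,n$ for a prime $r$ if $r\mid n$ and $r^2\nmid n$. Then $$ E=\begin{cases} 2^{k}\varphi(n), & p\,\|\,n,\ q\,\|\,n,\\ 3\cdot 2^{k-1}\varphi(n), & p=2,\ 2\,\|\,n,\ q^2\mid n,\\ 2^{k-1}\bigl(2\varphi(n)+\varphi(n/q)\varphi(q)\bigr), & p\neq 2,\ p\,\|\,n,\ q^2\mid n,\\ 2^{k-1}\bigl(2\varphi(n)+\varphi(n/p)\varphi(p)\bigr), & p^2\mid n,\ q\,\|\,n,\\ 2^{k-1}\bigl(2\varphi(n)+\varphi(n/p)\varphi(p)+\varphi(n/q)\varphi(q)\bigr), & p^2\mid n,\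 q^2\mid n. \end{cases} $$ -/

import Mathlib

/-- The energy of a finite simple graph: the sum of the absolute values of the eigenvalues
(counted with multiplicity) of its real adjacency matrix. -/
noncomputable def SimpleGraph.energy {V : Type*} [Fintype V] (G : SimpleGraph V) : ℝ :=
  letI : DecidableEq V := Classical.decEq V
  letI : DecidableRel G.Adj := Classical.decRel G.Adj
  have hA : (G.adjMatrix ℝ).IsHermitian := G.isHermitian_adjMatrix ℝ
  ∑ i, |hA.eigenvalues i|

/-- The set `G_n(d) = {k | gcd(k, n) = d, 1 ≤ k < n}`, as a set of residues modulo `n`. -/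
def gcdResidues (n d : ℕ) : Set (ZMod n) :=
  {x | ∃ k : ℕ, 1 ≤ k ∧ k < n ∧ Nat.gcd k n = d ∧ (k : ZMod n) = x}

/-- The integral circulant graph `ICG_n(D)` on the integers modulo `n`:
two vertices are adjacent iff they differ by an element of `⋃ d ∈ D, G_n(d)`. -/
def integralCirculantGraph (n : ℕ) (D : Set ℕ) : SimpleGraph (ZMod n) :=
  SimpleGraph.circulantGraph (⋃ d ∈ D, gcdResidues n d)

/-! The graph is a Cayley graph on `ZMod n`, so the additive characters diagonalise it and E = ∑
|c_p(ψ) + c_q(ψ)|, where c_d(ψ) is the Ramanujan-type sum of ψ over residues x with gcd(x, n) = d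
(`gcdSum`).

These sums are multiplicative under the Chinese remainder theorem (`gcdSum_mul`). Writing n = P·Q·m
with P and Q the p- and q-parts, the factor at m is c_1 in both terms, so E splits as `pairSum p q P
Q` times ∑ |c_1| over characters mod m, which is 2^ω(m) φ(m) (`energy_eq_pairSum_mul`,
`sum_norm_gcdSum_one`).

At a prime power r^(a+2), c_1 and c_r both vanish unless ψ has order 1, r or r²; there are 1, r - 1
and r² - r such characters. Hence `pairSum` has at most nine distinct terms, evaluated by hand. The
only sign that depends on the primes is that of (p-2)(q-1) - 1, for p ∥ n and q² ∣ n: it is negative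
exactly when p = 2, whence the exceptional case. -/

/-! ### Spectra of Cayley graphs on finite abelian groups -/

open Finset Polynomial in
/-- If a real Hermitian matrix has complex characteristic polynomial `∏ (X - f i)`, then the sum of
the absolute values of its eigenvalues is `∑ ‖f i‖`. -/
theorem Matrix.IsHermitian.sum_abs_eigenvalues_eq {V ι : Type*} [Fintype V] [DecidableEq V]
    [Fintype ι] {A : Matrix V V ℝ} (hA : A.IsHermitian) (f : ι → ℂ)
    (h : (A.map Complex.ofRealHom).charpoly = ∏ i, (X - C (f i))) :
    ∑ i, |hA.eigenvalues i| = ∑ i, ‖f i‖ := by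
  rw [Matrix.charpoly_map, hA.charpoly_eq, Polynomial.map_prod] at h
  have h' : (univ.val.map fun i => (hA.eigenvalues i : ℂ)) = univ.val.map f := by
    rw [← Polynomial.roots_multiset_prod_X_sub_C (univ.val.map fun i => (hA.eigenvalues i : ℂ)),
      ← Polynomial.roots_multiset_prod_X_sub_C (univ.val.map f), Multiset.map_map,
      Multiset.map_map]
    congr 1
    simp only [Polynomial.map_sub, Polynomial.map_X, Polynomial.map_C] at h
    exact h
  have h2 := congrArg (fun s => (s.map fun z : ℂ => ‖z‖).sum) h'
  simp only [Multiset.map_map, Function.comp_def, Complex.norm_real, Real.norm_eq_abs] at h2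
  exact h2

open Finset Polynomial in
/-- The characteristic polynomial of a convolution matrix on a finite abelian group, in terms of
the Fourier coefficients of the kernel. -/
theorem Matrix.charpoly_of_sub {G : Type*} [AddCommGroup G] [Fintype G] [DecidableEq G]
    (g : G → ℂ) :
    (Matrix.of fun x y => g (x - y)).charpoly =
      ∏ ψ : AddChar G ℂ, (X - C (∑ s, g s * ψ (-s))) := by
  classical
  set A : Matrix G G ℂ := Matrix.of fun x y => g (x - y) with hA
  let F : Matrix G (AddChar G ℂ) ℂ := Matrix.of fun x ψ => ψ x
  let F' : Matrix (AddChar G ℂ) G ℂ := Matrix.of fun ψ x => (Fintype.card G : ℂ)⁻¹ * ψ (-x)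
  let D : Matrix (AddChar G ℂ) (AddChar G ℂ) ℂ := Matrix.diagonal fun ψ => ∑ s, g s * ψ (-s)
  have hN : (Fintype.card G : ℂ) ≠ 0 := Nat.cast_ne_zero.2 Fintype.card_ne_zero
  have hFF' : F * F' = 1 := by
    ext x y
    simp only [F, F', Matrix.mul_apply, Matrix.of_apply, Matrix.one_apply]
    have : ∀ ψ : AddChar G ℂ, ψ x * ((Fintype.card G : ℂ)⁻¹ * ψ (-y)) =
        (Fintype.card G : ℂ)⁻¹ * ψ (x - y) := fun ψ => by
      rw [sub_eq_add_neg, AddChar.map_add_eq_mul]; ring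
    simp_rw [this]
    rw [← Finset.mul_sum, AddChar.sum_apply_eq_ite]
    simp only [sub_eq_zero]
    split_ifs <;> simp [hN]
  have hcard : Fintype.card G = Fintype.card (AddChar G ℂ) := AddChar.card_eq.symm
  have hF'F : F' * F = 1 := (Matrix.mul_eq_one_comm_of_card_eq _ _ _ hcard).1 hFF'
  have hAF : A * F = F * D := by
    ext x ψ
    have hD : (F * D) x ψ = ψ x * ∑ s, g s * ψ (-s) := Matrix.mul_diagonal ..
    rw [hD, Matrix.mul_apply]
    simp only [A, F, Matrix.of_apply]
    rw [Finset.mul_sum, ← Equiv.sum_comp (Equiv.subLeft x)]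
    refine Finset.sum_congr rfl fun y _ => ?_
    simp only [Equiv.subLeft_apply, sub_sub_cancel]
    rw [sub_eq_add_neg, AddChar.map_add_eq_mul]; ring
  have hA' : A = (F * D) * F' := by
    rw [← hAF, Matrix.mul_assoc, hFF', Matrix.mul_one]
  -- `F` and `F'` are indexed by different types, so swapping the factors costs a power of X; its
  -- exponent is 0 since a finite abelian group and its dual have the same cardinality.
  rw [hA', Matrix.charpoly_mul_comm_of_le _ _ hcard.symm.le, hcard, Nat.sub_self, pow_zero,
    one_mul, ← Matrix.mul_assoc, hF'F, Matrix.one_mul, Matrix.charpoly_diagonal]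

open Finset in
/-- The energy of a circulant graph on a finite abelian group, as a sum over characters. -/
theorem SimpleGraph.energy_circulantGraph {G : Type*} [AddCommGroup G] [Fintype G]
    (S : Finset G) (h0 : 0 ∉ S) (hS : ∀ x, -x ∈ S ↔ x ∈ S) :
    (SimpleGraph.circulantGraph (S : Set G)).energy = ∑ ψ : AddChar G ℂ, ‖∑ s ∈ S, ψ s‖ := by
  let : DecidableEq G := Classical.decEq G
  refine Matrix.IsHermitian.sum_abs_eigenvalues_eq _ _ ?_
  have hAdj : ∀ x y, (SimpleGraph.circulantGraph (S : Set G)).Adj x y ↔ x - y ∈ S := by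
    intro x y
    rw [SimpleGraph.circulantGraph_adj]
    have h2 : y - x ∈ S ↔ x - y ∈ S := by rw [← neg_sub, hS]
    simp only [Finset.mem_coe, h2, or_self, and_iff_right_iff_imp]
    rintro h rfl
    exact h0 (by simpa using h)
  have hM := Matrix.charpoly_of_sub (fun x : G => if x ∈ S then (1 : ℂ) else 0)
  have hsum : ∀ ψ : AddChar G ℂ, ∑ s, (if s ∈ S then (1 : ℂ) else 0) * ψ (-s) = ∑ s ∈ S, ψ s := by
    intro ψ
    rw [← Equiv.sum_comp (Equiv.neg G)]
    simp [hS]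
  simp_rw [hsum] at hM
  rw [← hM]
  convert rfl using 2
  ext x y
  simp only [SimpleGraph.adjMatrix_apply, Matrix.map_apply, Matrix.of_apply, hAdj]
  split_ifs <;> simp

/-! ### Gcd sums and the energy of the pair graph -/

/-- The sum of an additive character over the residues with prescribed gcd with the modulus. -/
noncomputable def gcdSum (N d : ℕ) [NeZero N] (ψ : AddChar (ZMod N) ℂ) : ℂ :=
  ∑ x : ZMod N with Nat.gcd x.val N = d, ψ x

theorem ZMod.gcd_val_natCast (N k : ℕ) : Nat.gcd (k : ZMod N).val N = Nat.gcd k N := by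
  rw [ZMod.val_natCast, ← Nat.gcd_rec, Nat.gcd_comm]

theorem ZMod.gcd_val_neg (N : ℕ) [NeZero N] (x : ZMod N) :
    Nat.gcd (-x).val N = Nat.gcd x.val N := by
  rw [ZMod.neg_val]
  split_ifs with h
  · simp [h]
  · exact Nat.gcd_self_sub_left x.val_lt.le

/-- The condition 1 ≤ k discards only the residue 0, whose gcd with n is n; hence `d ≠ n`. -/
theorem mem_gcdResidues {n d : ℕ} [NeZero n] (hd : d ≠ n) (x : ZMod n) :
    x ∈ gcdResidues n d ↔ Nat.gcd x.val n = d := by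
  constructor
  · rintro ⟨k, -, -, h, rfl⟩
    rw [ZMod.gcd_val_natCast, h]
  · intro h
    refine ⟨x.val, ?_, x.val_lt, h, ZMod.natCast_zmod_val x⟩
    rw [Nat.one_le_iff_ne_zero]
    intro h0
    rw [h0, Nat.gcd_zero_left] at h
    exact hd h.symm

theorem energy_integralCirculantGraph_pair {n : ℕ} [NeZero n] {p q : ℕ} (hp : p ≠ n)
    (hq : q ≠ n) (hpq : p ≠ q) :
    (integralCirculantGraph n {p, q}).energy =
      ∑ ψ : AddChar (ZMod n) ℂ, ‖gcdSum n p ψ + gcdSum n q ψ‖ := by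
  have hS : (⋃ d ∈ ({p, q} : Set ℕ), gcdResidues n d) =
      ((Finset.univ.filter fun x : ZMod n => Nat.gcd x.val n = p ∨ Nat.gcd x.val n = q :
        Finset (ZMod n)) : Set (ZMod n)) := by
    ext x
    simp [mem_gcdResidues hp, mem_gcdResidues hq]
  rw [integralCirculantGraph, hS, SimpleGraph.energy_circulantGraph]
  · refine Finset.sum_congr rfl fun ψ _ => ?_
    rw [gcdSum, gcdSum, Finset.filter_or, Finset.sum_union]
    exact Finset.disjoint_filter.2 fun x _ h h' => hpq (h.symm.trans h')
  · simp [hp.symm, hq.symm]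
  · intro x
    simp [ZMod.gcd_val_neg]

/-! ### Factorisation by the Chinese remainder theorem -/

/-- The character of `ZMod (M * N)` obtained from characters of `ZMod M` and `ZMod N`. -/
noncomputable def AddChar.zmodMul {M N : ℕ} (ψ : AddChar (ZMod M) ℂ) (χ : AddChar (ZMod N) ℂ) :
    AddChar (ZMod (M * N)) ℂ :=
  ψ.compAddMonoidHom (ZMod.castHom (dvd_mul_right M N) (ZMod M)).toAddMonoidHom *
    χ.compAddMonoidHom (ZMod.castHom (dvd_mul_left N M) (ZMod N)).toAddMonoidHom

section Coprime

variable {M N : ℕ}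

theorem AddChar.zmodMul_chineseRemainder_symm (h : M.Coprime N) (ψ : AddChar (ZMod M) ℂ)
    (χ : AddChar (ZMod N) ℂ) (x : ZMod M × ZMod N) :
    ψ.zmodMul χ ((ZMod.chineseRemainder h).symm x) = ψ x.1 * χ x.2 := by
  obtain ⟨y, rfl⟩ := (ZMod.chineseRemainder h).surjective x
  rw [RingEquiv.symm_apply_apply]
  have h1 : (ZMod.chineseRemainder h y).1 = ZMod.castHom (dvd_mul_right M N) (ZMod M) y := by
    simp [ZMod.chineseRemainder, ZMod.castHom_apply]
  have h2 : (ZMod.chineseRemainder h y).2 = ZMod.castHom (dvd_mul_left N M) (ZMod N) y := by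
    simp [ZMod.chineseRemainder, ZMod.castHom_apply]
  rw [h1, h2]
  rfl

variable [NeZero M] [NeZero N]

theorem AddChar.sum_zmodMul (h : M.Coprime N) (F : AddChar (ZMod (M * N)) ℂ → ℝ) :
    ∑ ψ, F ψ = ∑ ψ : AddChar (ZMod M) ℂ, ∑ χ : AddChar (ZMod N) ℂ, F (ψ.zmodMul χ) := by
  rw [← Fintype.sum_prod_type']
  have hinj : Function.Injective
      fun x : AddChar (ZMod M) ℂ × AddChar (ZMod N) ℂ => x.1.zmodMul x.2 := by
    rintro ⟨ψ, χ⟩ ⟨ψ', χ'⟩ heq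
    have key : ∀ x : ZMod M × ZMod N, ψ x.1 * χ x.2 = ψ' x.1 * χ' x.2 := fun x => by
      rw [← zmodMul_chineseRemainder_symm h, ← zmodMul_chineseRemainder_symm h]
      exact DFunLike.congr_fun heq _
    refine Prod.ext (DFunLike.ext _ _ fun x => ?_) (DFunLike.ext _ _ fun x => ?_)
    · simpa using key (x, 0)
    · simpa using key (0, x)
  have hbij := (Fintype.bijective_iff_injective_and_card _).2 ⟨hinj, by
    simp only [Fintype.card_prod, AddChar.card_eq, ZMod.card]⟩
  exact (Function.Bijective.sum_comp hbij F).symm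

/-- Since gcd(k, MN) = gcd(k, M) gcd(k, N), and a divisor of MN splits uniquely into divisors of M
and of N, the index set is a product and the double sum factors. -/
theorem gcdSum_mul (h : M.Coprime N) {d e : ℕ} (hd : d ∣ M) (he : e ∣ N)
    (ψ : AddChar (ZMod M) ℂ) (χ : AddChar (ZMod N) ℂ) :
    gcdSum (M * N) (d * e) (ψ.zmodMul χ) = gcdSum M d ψ * gcdSum N e χ := by
  have hgcd : ∀ x : ZMod M × ZMod N,
      Nat.gcd ((ZMod.chineseRemainder h).symm x).val (M * N) = d * e ↔
        Nat.gcd x.1.val M = d ∧ Nat.gcd x.2.val N = e := by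
    intro x
    obtain ⟨y, rfl⟩ := (ZMod.chineseRemainder h).surjective x
    obtain ⟨k, rfl⟩ := ZMod.natCast_zmod_surjective y
    rw [RingEquiv.symm_apply_apply, map_natCast, Prod.fst_natCast, Prod.snd_natCast]
    simp only [ZMod.gcd_val_natCast]
    rw [h.gcd_mul]
    refine ⟨fun hk => ?_, fun hk => by rw [hk.1, hk.2]⟩
    have hM := Nat.gcd_dvd_right k M
    have hN := Nat.gcd_dvd_right k N
    constructor
    · refine Nat.dvd_antisymm ?_ ?_
      · exact (Nat.Coprime.of_dvd hM he h).dvd_of_dvd_mul_right (hk ▸ dvd_mul_right _ _)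
      · exact (Nat.Coprime.of_dvd hd hN h).dvd_of_dvd_mul_right (hk ▸ dvd_mul_right _ _)
    · refine Nat.dvd_antisymm ?_ ?_
      · exact (Nat.Coprime.of_dvd hd hN h).symm.dvd_of_dvd_mul_left (hk ▸ dvd_mul_left _ _)
      · exact (Nat.Coprime.of_dvd hM he h).symm.dvd_of_dvd_mul_left (hk ▸ dvd_mul_left _ _)
  unfold gcdSum
  rw [Finset.sum_filter, Finset.sum_filter, Finset.sum_filter, Finset.sum_mul_sum,
    ← Equiv.sum_comp (ZMod.chineseRemainder h).symm.toEquiv, Fintype.sum_prod_type]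
  refine Finset.sum_congr rfl fun x _ => Finset.sum_congr rfl fun y _ => ?_
  have h1 := hgcd (x, y)
  have h2 := AddChar.zmodMul_chineseRemainder_symm h ψ χ (x, y)
  simp only [RingEquiv.toEquiv_eq_coe, EquivLike.coe_coe, h1, h2]
  by_cases ha : Nat.gcd x.val M = d <;> by_cases hb : Nat.gcd y.val N = e <;> simp [ha, hb]

end Coprime

/-! ### Gcd sums at prime powers -/

/-- The sum of an additive character of `ZMod N` over the multiples of a divisor `d` of `N`. -/
theorem AddChar.sum_dvd_val {N d M : ℕ} [NeZero N] (h : d * M = N) (ψ : AddChar (ZMod N) ℂ) :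
    ∑ x : ZMod N with d ∣ x.val, ψ x = if ψ (d : ZMod N) = 1 then (M : ℂ) else 0 := by
  have hN := NeZero.pos N
  have hd : 0 < d := Nat.pos_of_ne_zero fun h0 => by simp [h0] at h; omega
  have hval : ∀ i ∈ Finset.range M, ((d * i : ℕ) : ZMod N).val = d * i := fun i hi =>
    ZMod.val_natCast_of_lt (h ▸ Nat.mul_lt_mul_of_pos_left (Finset.mem_range.1 hi) hd)
  -- The multiples of d are d·i with i < M, giving a geometric sum of ratio ψ(d), and ψ(d)^M = ψ(N)
  -- = 1.
  have hsum : ∑ x : ZMod N with d ∣ x.val, ψ x =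
      ∑ i ∈ Finset.range M, ψ (d : ZMod N) ^ i := by
    symm
    refine Finset.sum_bij' (fun i _ => ((d * i : ℕ) : ZMod N)) (fun x _ => x.val / d) ?_ ?_ ?_ ?_ ?_
    · intro i hi
      simp only [Finset.mem_filter, Finset.mem_univ, true_and]
      rw [hval i hi]
      exact dvd_mul_right d i
    · intro x _
      rw [Finset.mem_range]
      exact Nat.div_lt_of_lt_mul (h.symm ▸ x.val_lt)
    · intro i hi
      rw [hval i hi, Nat.mul_div_cancel_left i hd]
    · intro x hx
      rw [Nat.mul_div_cancel' (Finset.mem_filter.1 hx).2, ZMod.natCast_zmod_val]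
    · intro i _
      rw [← AddChar.map_nsmul_eq_pow, nsmul_eq_mul, mul_comm, Nat.cast_mul]
  rw [hsum]
  split_ifs with h1
  · simp [h1]
  · have hpow : ψ (d : ZMod N) ^ M = 1 := by
      rw [← AddChar.map_nsmul_eq_pow, nsmul_eq_mul, mul_comm, ← Nat.cast_mul, h,
        ZMod.natCast_self, AddChar.map_zero_eq_one]
    rw [geom_sum_eq h1, hpow, sub_self, zero_div]

theorem AddChar.card_apply_natCast_eq_one {N d : ℕ} [NeZero N] (h : d ∣ N) :
    (Finset.univ.filter fun ψ : AddChar (ZMod N) ℂ => ψ (d : ZMod N) = 1).card = d := by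
  obtain ⟨M, hM⟩ := h
  have hN := NeZero.ne N
  -- Double counting: summed over ψ first, only x = 0 contributes; summed over x first, each ψ
  -- trivial on d contributes M.
  have key : ∑ ψ : AddChar (ZMod N) ℂ, ∑ x : ZMod N with d ∣ x.val, ψ x = N := by
    rw [Finset.sum_comm]
    simp_rw [AddChar.sum_apply_eq_ite]
    simp
  simp_rw [AddChar.sum_dvd_val hM.symm] at key
  rw [← Finset.sum_filter, Finset.sum_const, nsmul_eq_mul, ← Nat.cast_mul, Nat.cast_inj] at key
  have hM0 : 0 < M := Nat.pos_of_ne_zero fun h0 => hN (by simp [hM, h0])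
  exact Nat.eq_of_mul_eq_mul_right hM0 (key.trans hM)

theorem AddChar.sum_ite_apply_natCast {N d : ℕ} [NeZero N] (h : d ∣ N) (c : ℝ) :
    ∑ ψ : AddChar (ZMod N) ℂ, (if ψ (d : ZMod N) = 1 then c else 0) = d * c := by
  rw [← Finset.sum_filter, Finset.sum_const, nsmul_eq_mul, card_apply_natCast_eq_one h]

section PrimePow

variable {r : ℕ}

theorem Nat.gcd_pow_eq_one_iff (hr : r.Prime) (a x : ℕ) :
    Nat.gcd x (r ^ (a + 1)) = 1 ↔ ¬ r ∣ x := by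
  rw [← Nat.coprime_iff_gcd_eq_one, Nat.coprime_pow_right_iff (Nat.succ_pos a),
    Nat.coprime_comm, hr.coprime_iff_not_dvd]

theorem Nat.gcd_pow_eq_self_iff (hr : r.Prime) (a x : ℕ) :
    Nat.gcd x (r ^ (a + 2)) = r ↔ r ∣ x ∧ ¬ r ^ 2 ∣ x := by
  constructor
  · intro h
    refine ⟨h ▸ Nat.gcd_dvd_left _ _, fun h2 => ?_⟩
    have h3 : r ^ 2 ∣ r := by
      have := Nat.dvd_gcd h2 (pow_dvd_pow r (by omega : 2 ≤ a + 2))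
      rwa [h] at this
    have := Nat.le_of_dvd hr.pos h3
    nlinarith [hr.two_le]
  · rintro ⟨⟨y, rfl⟩, h2⟩
    have hy : ¬ r ∣ y := fun hy => h2 (by rw [pow_two]; exact mul_dvd_mul_left r hy)
    rw [pow_succ', Nat.gcd_mul_left, (Nat.gcd_pow_eq_one_iff hr a y).2 hy, mul_one]

variable (r) in
theorem gcdSum_one_prime_pow (hr : r.Prime) (a : ℕ) [NeZero (r ^ (a + 1))]
    (ψ : AddChar (ZMod (r ^ (a + 1))) ℂ) :
    gcdSum (r ^ (a + 1)) 1 ψ = (if ψ ((1 : ℕ) : ZMod (r ^ (a + 1))) = 1 then (r : ℂ) ^ (a + 1) else 0)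
      - if ψ (r : ZMod (r ^ (a + 1))) = 1 then (r : ℂ) ^ a else 0 := by
  have h1 := AddChar.sum_dvd_val (one_mul (r ^ (a + 1))) ψ
  have h2 := AddChar.sum_dvd_val (pow_succ' r a).symm ψ
  rw [Nat.cast_pow] at h1 h2
  rw [← h1, ← h2, gcdSum, eq_sub_iff_add_eq]
  simp only [Nat.gcd_pow_eq_one_iff hr, one_dvd, Finset.filter_true]
  rw [add_comm, Finset.sum_filter_add_sum_filter_not]

/-- With exponent at least 2, gcd r means a multiple of r that is not a multiple of r², so two
subgroup sums are subtracted. -/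
theorem gcdSum_self_prime_pow (hr : r.Prime) (a : ℕ) [NeZero (r ^ (a + 2))]
    (ψ : AddChar (ZMod (r ^ (a + 2))) ℂ) :
    gcdSum (r ^ (a + 2)) r ψ = (if ψ (r : ZMod (r ^ (a + 2))) = 1 then (r : ℂ) ^ (a + 1) else 0)
      - if ψ ((r ^ 2 : ℕ) : ZMod (r ^ (a + 2))) = 1 then (r : ℂ) ^ a else 0 := by
  have h1 := AddChar.sum_dvd_val (pow_succ' r (a + 1)).symm ψ
  have h2 := AddChar.sum_dvd_val (show r ^ 2 * r ^ a = r ^ (a + 2) by ring) ψ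
  rw [Nat.cast_pow r (a + 1)] at h1
  rw [Nat.cast_pow r a] at h2
  rw [← h1, ← h2, gcdSum, eq_sub_iff_add_eq]
  simp only [Nat.gcd_pow_eq_self_iff hr]
  rw [← Finset.filter_filter, add_comm]
  rw [← Finset.sum_filter_add_sum_filter_not
    (Finset.univ.filter fun x : ZMod (r ^ (a + 2)) => r ∣ x.val) (fun x => r ^ 2 ∣ x.val)]
  congr 2
  ext x
  simp only [Finset.mem_filter, Finset.mem_univ, true_and, iff_and_self]
  exact fun h => (dvd_pow_self r two_ne_zero).trans h

theorem gcdSum_self {N : ℕ} [NeZero N] (ψ : AddChar (ZMod N) ℂ) : gcdSum N N ψ = 1 := by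
  have h := AddChar.sum_dvd_val (mul_one N) ψ
  rw [ZMod.natCast_self, AddChar.map_zero_eq_one, if_pos rfl, Nat.cast_one] at h
  simpa only [gcdSum, Nat.gcd_eq_right_iff_dvd] using h

theorem AddChar.apply_natCast_eq_one_of_dvd {N d e : ℕ} {ψ : AddChar (ZMod N) ℂ} (hde : d ∣ e)
    (h : ψ (d : ZMod N) = 1) : ψ (e : ZMod N) = 1 := by
  obtain ⟨c, rfl⟩ := hde
  rw [Nat.cast_mul, mul_comm, ← nsmul_eq_mul, AddChar.map_nsmul_eq_pow, h, one_pow]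

/-- Sum over the characters modulo a prime of a function of the two gcd sums. -/
theorem sum_gcdSum_prime (hr : r.Prime) [NeZero (r ^ 1)] (G : ℂ → ℂ → ℝ) :
    ∑ ψ : AddChar (ZMod (r ^ 1)) ℂ, G (gcdSum (r ^ 1) 1 ψ) (gcdSum (r ^ 1) r ψ) =
      G ((r - 1 : ℝ) : ℂ) (1 : ℝ) + ((r : ℝ) - 1) * G (-1 : ℝ) (1 : ℝ) := by
  have hterm : ∀ ψ : AddChar (ZMod (r ^ 1)) ℂ, G (gcdSum (r ^ 1) 1 ψ) (gcdSum (r ^ 1) r ψ) =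
      (if ψ ((1 : ℕ) : ZMod (r ^ 1)) = 1 then
        G ((r - 1 : ℝ) : ℂ) (1 : ℝ) - G (-1 : ℝ) (1 : ℝ) else 0)
      + if ψ (r : ZMod (r ^ 1)) = 1 then G (-1 : ℝ) (1 : ℝ) else 0 := by
    intro ψ
    -- At exponent 1, gcd r singles out the residue 0, so this sum is 1 for every ψ.
    have h1 : gcdSum (r ^ 1) r ψ = 1 := by
      simpa only [pow_one] using gcdSum_self (N := r ^ 1) ψ
    have h2 : gcdSum (r ^ 1) 1 ψ = (if ψ ((1 : ℕ) : ZMod (r ^ 1)) = 1 then (r : ℂ) else 0)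
        - if ψ (r : ZMod (r ^ 1)) = 1 then 1 else 0 := by
      refine (gcdSum_one_prime_pow r hr 0 ψ).trans ?_
      have e : (r : ℂ) ^ (0 + 1) = r := pow_one _
      rw [e, pow_zero]
    have h3 : ψ (r : ZMod (r ^ 1)) = 1 := by
      have : (r : ZMod (r ^ 1)) = 0 := by
        rw [ZMod.natCast_eq_zero_iff, pow_one]
      rw [this, AddChar.map_zero_eq_one]
    rw [h1, h2, if_pos h3, if_pos h3]
    by_cases h4 : ψ ((1 : ℕ) : ZMod (r ^ 1)) = 1
    · rw [if_pos h4, if_pos h4]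
      push_cast
      ring
    · rw [if_neg h4, if_neg h4]
      push_cast
      ring_nf
  simp_rw [hterm]
  rw [Finset.sum_add_distrib, AddChar.sum_ite_apply_natCast (one_dvd _),
    AddChar.sum_ite_apply_natCast (by simp)]
  push_cast
  ring

/-- Sum over the characters modulo a prime power `r ^ (a + 2)` of a function of the two gcd sums. -/
theorem sum_gcdSum_prime_pow (hr : r.Prime) (a : ℕ) [NeZero (r ^ (a + 2))] (G : ℂ → ℂ → ℝ)
    (hG : G 0 0 = 0) :
    ∑ ψ : AddChar (ZMod (r ^ (a + 2))) ℂ,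
        G (gcdSum (r ^ (a + 2)) 1 ψ) (gcdSum (r ^ (a + 2)) r ψ) =
      G (r ^ a * (r * (r - 1)) : ℝ) (r ^ a * (r - 1) : ℝ)
        + ((r : ℝ) - 1) * G (-(r ^ a * r) : ℝ) (r ^ a * (r - 1) : ℝ)
        + ((r : ℝ) ^ 2 - r) * G (0 : ℝ) (-(r ^ a) : ℝ) := by
  set g₀ := G (r ^ a * (r * (r - 1)) : ℝ) (r ^ a * (r - 1) : ℝ)
  set g₁ := G (-(r ^ a * r) : ℝ) (r ^ a * (r - 1) : ℝ)
  set g₂ := G (0 : ℝ) (-(r ^ a) : ℝ)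
  -- The conditions ψ(1) = 1, ψ(r) = 1, ψ(r²) = 1 are nested, so the value telescopes into
  -- indicators satisfied by 1, r and r² characters; outside the last one `hG` gives 0.
  have hterm : ∀ ψ : AddChar (ZMod (r ^ (a + 2))) ℂ,
      G (gcdSum (r ^ (a + 2)) 1 ψ) (gcdSum (r ^ (a + 2)) r ψ) =
      (if ψ ((1 : ℕ) : ZMod (r ^ (a + 2))) = 1 then g₀ - g₁ else 0)
      + (if ψ (r : ZMod (r ^ (a + 2))) = 1 then g₁ - g₂ else 0)
      + if ψ ((r ^ 2 : ℕ) : ZMod (r ^ (a + 2))) = 1 then g₂ else 0 := by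
    intro ψ
    rw [gcdSum_one_prime_pow r hr (a + 1), gcdSum_self_prime_pow hr a]
    have h12 := AddChar.apply_natCast_eq_one_of_dvd (ψ := ψ) (one_dvd r)
    have h23 := AddChar.apply_natCast_eq_one_of_dvd (ψ := ψ) (dvd_pow_self r two_ne_zero)
    by_cases h3 : ψ ((r ^ 2 : ℕ) : ZMod (r ^ (a + 2))) = 1
    · by_cases h2 : ψ (r : ZMod (r ^ (a + 2))) = 1
      · by_cases h1 : ψ ((1 : ℕ) : ZMod (r ^ (a + 2))) = 1
        · simp only [if_pos h1, if_pos h2, if_pos h3]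
          simp only [g₀]
          push_cast
          ring_nf
        · simp only [if_neg h1, if_pos h2, if_pos h3, zero_sub]
          simp only [g₁]
          push_cast
          ring_nf
      · have h1 := mt h12 h2
        simp only [if_neg h1, if_neg h2, if_pos h3, zero_sub, sub_zero]
        simp only [g₂]
        push_cast
        ring
    · have h2 := mt h23 h3
      have h1 := mt h12 h2
      simp only [if_neg h1, if_neg h2, if_neg h3, sub_zero, hG, add_zero]
  simp_rw [hterm]
  rw [Finset.sum_add_distrib, Finset.sum_add_distrib, AddChar.sum_ite_apply_natCast (one_dvd _),
    AddChar.sum_ite_apply_natCast (dvd_pow_self r (by omega)),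
    AddChar.sum_ite_apply_natCast (pow_dvd_pow r (by omega))]
  push_cast
  ring

end PrimePow

/-- The energy of the unitary Cayley graph modulo `m`, as a sum over characters. -/
theorem sum_norm_gcdSum_one (m : ℕ) [NeZero m] :
    ∑ ψ : AddChar (ZMod m) ℂ, ‖gcdSum m 1 ψ‖ = 2 ^ m.primeFactors.card * (m.totient : ℝ) := by
  suffices H : ∀ m : ℕ, ∀ hm : m ≠ 0, haveI : NeZero m := ⟨hm⟩
      ∑ ψ : AddChar (ZMod m) ℂ, ‖gcdSum m 1 ψ‖ = 2 ^ m.primeFactors.card * (m.totient : ℝ) from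
    H m (NeZero.ne m)
  intro m
  induction m using Nat.recOnPosPrimePosCoprime with
  | zero => exact fun h => (h rfl).elim
  | one =>
    intro h
    have := NeZero.mk h
    simp only [gcdSum_self, Finset.sum_const, Finset.card_univ, AddChar.card_eq, ZMod.card]
    simp
  | prime_pow r a hr ha =>
    intro h
    have := NeZero.mk h
    rw [Nat.primeFactors_prime_pow ha.ne' hr, Finset.card_singleton, pow_one]
    have hr1 : (1 : ℝ) ≤ r := by exact_mod_cast hr.one_le
    obtain rfl | ⟨b, rfl⟩ : a = 1 ∨ ∃ b, a = b + 2 := by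
      rcases a with _ | _ | b
      · omega
      · exact Or.inl rfl
      · exact Or.inr ⟨b, rfl⟩
    · rw [sum_gcdSum_prime hr fun u _ => ‖u‖]
      simp only [Complex.norm_real, Real.norm_eq_abs, abs_neg, abs_one]
      rw [abs_of_nonneg (sub_nonneg.2 hr1), pow_one, Nat.totient_prime hr,
        Nat.cast_sub hr.one_le]
      push_cast
      ring
    · rw [sum_gcdSum_prime_pow hr b (fun u _ => ‖u‖) norm_zero]
      simp only [Complex.norm_real, Real.norm_eq_abs, abs_neg, abs_zero]
      rw [abs_of_nonneg (by have := sub_nonneg.2 hr1; positivity), abs_of_nonneg (by positivity),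
        Nat.totient_prime_pow_succ hr, Nat.cast_mul, Nat.cast_sub hr.one_le]
      push_cast
      ring
  | coprime a b ha hb hab iha ihb =>
    intro h
    have ha0 : a ≠ 0 := by omega
    have hb0 : b ≠ 0 := by omega
    have := NeZero.mk ha0
    have := NeZero.mk hb0
    have iha := iha ha0
    have ihb := ihb hb0
    rw [AddChar.sum_zmodMul hab]
    have hmul := fun ψ χ => gcdSum_mul hab (one_dvd a) (one_dvd b) ψ χ
    rw [one_mul] at hmul
    simp_rw [hmul, norm_mul]
    rw [← Finset.sum_mul_sum, iha, ihb, hab.primeFactors_mul,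
      Finset.card_union_of_disjoint hab.disjoint_primeFactors, Nat.totient_mul hab]
    push_cast
    ring

/-! ### The two prime power components at p and q -/

section PairSum

variable {p q : ℕ}

/-- The contribution of two prime power components to the energy of `ICG_n({p, q})`. -/
noncomputable def pairSum (p q P Q : ℕ) [NeZero P] [NeZero Q] : ℝ :=
  ∑ ψ : AddChar (ZMod P) ℂ, ∑ χ : AddChar (ZMod Q) ℂ,
    ‖gcdSum P p ψ * gcdSum Q 1 χ + gcdSum P 1 ψ * gcdSum Q q χ‖

theorem pairSum_comm (p q P Q : ℕ) [NeZero P] [NeZero Q] :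
    pairSum p q P Q = pairSum q p Q P := by
  unfold pairSum
  rw [Finset.sum_comm]
  refine Finset.sum_congr rfl fun ψ _ => Finset.sum_congr rfl fun χ _ => ?_
  congr 1
  ring

theorem pairSum_prime_prime (hp : p.Prime) (hq : q.Prime) [NeZero (p ^ 1)] [NeZero (q ^ 1)] :
    pairSum p q (p ^ 1) (q ^ 1) = 4 * (((p : ℝ) - 1) * (q - 1)) := by
  have hp2 : (2 : ℝ) ≤ p := by exact_mod_cast hp.two_le
  have hq2 : (2 : ℝ) ≤ q := by exact_mod_cast hq.two_le
  unfold pairSum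
  simp_rw [fun ψ : AddChar (ZMod (p ^ 1)) ℂ => sum_gcdSum_prime hq
    (fun u f => ‖gcdSum (p ^ 1) p ψ * u + gcdSum (p ^ 1) 1 ψ * f‖)]
  rw [sum_gcdSum_prime hp (fun u f => ‖f * ((q - 1 : ℝ) : ℂ) + u * (1 : ℝ)‖
    + ((q : ℝ) - 1) * ‖f * (-1 : ℝ) + u * (1 : ℝ)‖)]
  simp only [← Complex.ofReal_mul, ← Complex.ofReal_add, Complex.norm_real, Real.norm_eq_abs]
  rw [abs_of_nonneg (by linarith), abs_of_nonneg (by linarith), abs_of_nonneg (by linarith),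
    abs_of_nonpos (by norm_num)]
  ring

/-- The remaining absolute value is |(p-2)(q-1) - 1|, from trivial ψ and χ of order q. No order on p
and q is assumed, so the lemma also serves with the primes exchanged. -/
theorem pairSum_prime_prime_pow (hp : p.Prime) (hq : q.Prime) (b : ℕ) [NeZero (p ^ 1)]
    [NeZero (q ^ (b + 2))] :
    pairSum p q (p ^ 1) (q ^ (b + 2)) =
      (q : ℝ) ^ b * (q - 1) * ((p + q - 1) + |(p : ℝ) * q - p - 2 * q + 1|
        + q * (p - 1) + (p - 1) * (4 * q - 2)) := by
  have hp2 : (2 : ℝ) ≤ p := by exact_mod_cast hp.two_le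
  have hq2 : (2 : ℝ) ≤ q := by exact_mod_cast hq.two_le
  unfold pairSum
  simp_rw [fun ψ : AddChar (ZMod (p ^ 1)) ℂ => sum_gcdSum_prime_pow hq b
    (fun u f => ‖gcdSum (p ^ 1) p ψ * u + gcdSum (p ^ 1) 1 ψ * f‖) (by simp)]
  rw [sum_gcdSum_prime hp (fun u f =>
    ‖f * ((q ^ b * (q * (q - 1)) : ℝ) : ℂ) + u * ((q ^ b * (q - 1) : ℝ) : ℂ)‖
    + ((q : ℝ) - 1) * ‖f * ((-(q ^ b * q) : ℝ) : ℂ) + u * ((q ^ b * (q - 1) : ℝ) : ℂ)‖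
    + ((q : ℝ) ^ 2 - q) * ‖f * (0 : ℝ) + u * ((-(q ^ b) : ℝ) : ℂ)‖)]
  simp only [← Complex.ofReal_mul, ← Complex.ofReal_add, Complex.norm_real, Real.norm_eq_abs]
  set y : ℝ := (q : ℝ) ^ b
  have hy : 0 ≤ y := by positivity
  have e1 : 1 * (y * (q * (q - 1))) + ((p : ℝ) - 1) * (y * (q - 1)) = y * ((q - 1) * (p + q - 1)) := by
    ring
  have e2 : 1 * (-(y * q)) + ((p : ℝ) - 1) * (y * (q - 1)) = y * (p * q - p - 2 * q + 1) := by ring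
  have e3 : 1 * 0 + ((p : ℝ) - 1) * -y = -(y * (p - 1)) := by ring
  have e4 : 1 * (y * (q * (q - 1))) + -1 * (y * ((q : ℝ) - 1)) = y * ((q - 1) * (q - 1)) := by ring
  have e5 : 1 * (-(y * q)) + -1 * (y * ((q : ℝ) - 1)) = -(y * (2 * q - 1)) := by ring
  have e6 : 1 * 0 + -1 * -y = y := by ring
  have hp1 : (0 : ℝ) ≤ p - 1 := by linarith
  have hq1 : (0 : ℝ) ≤ q - 1 := by linarith
  have hq3 : (0 : ℝ) ≤ 2 * q - 1 := by linarith
  have hpq : (0 : ℝ) ≤ p + q - 1 := by linarith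
  rw [e1, e2, e3, e4, e5, e6]
  simp only [abs_neg, abs_mul, abs_of_nonneg hy, abs_of_nonneg hp1, abs_of_nonneg hq1,
    abs_of_nonneg hq3, abs_of_nonneg hpq]
  ring

theorem pairSum_two_prime_pow (hq : q.Prime) (b : ℕ) [NeZero (2 ^ 1)] [NeZero (q ^ (b + 2))] :
    pairSum 2 q (2 ^ 1) (q ^ (b + 2)) = 6 * ((q : ℝ) ^ b * (q * (q - 1))) := by
  rw [pairSum_prime_prime_pow Nat.prime_two hq]
  have e : ((2 : ℕ) : ℝ) * q - (2 : ℕ) - 2 * q + 1 = -1 := by push_cast; ring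
  rw [e, abs_neg, abs_one]
  push_cast
  ring

theorem pairSum_odd_prime_prime_pow (hp : p.Prime) (hp3 : 3 ≤ p) (hq : q.Prime) (b : ℕ)
    [NeZero (p ^ 1)] [NeZero (q ^ (b + 2))] :
    pairSum p q (p ^ 1) (q ^ (b + 2)) =
      2 * ((p - 1) * ((q : ℝ) ^ b * (q - 1)) * (3 * q - 1)) := by
  have hp' : (3 : ℝ) ≤ p := by exact_mod_cast hp3
  have hq2 : (2 : ℝ) ≤ q := by exact_mod_cast hq.two_le
  rw [pairSum_prime_prime_pow hp hq, abs_of_nonneg (by nlinarith)]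
  ring

theorem pairSum_prime_pow_prime_pow (hp : p.Prime) (hq : q.Prime) (hpq : p < q) (a b : ℕ)
    [NeZero (p ^ (a + 2))] [NeZero (q ^ (b + 2))] :
    pairSum p q (p ^ (a + 2)) (q ^ (b + 2)) =
      2 * ((p : ℝ) ^ a * q ^ b * ((p - 1) * (q - 1)))
        * (2 * (p * q) + p * (q - 1) + q * (p - 1)) := by
  have hp2 : (2 : ℝ) ≤ p := by exact_mod_cast hp.two_le
  have hq2 : (3 : ℝ) ≤ q := by exact_mod_cast (hp.two_le.trans_lt hpq : 2 < q)
  unfold pairSum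
  simp_rw [fun ψ : AddChar (ZMod (p ^ (a + 2))) ℂ => sum_gcdSum_prime_pow hq b
    (fun u f => ‖gcdSum (p ^ (a + 2)) p ψ * u + gcdSum (p ^ (a + 2)) 1 ψ * f‖) (by simp)]
  rw [sum_gcdSum_prime_pow hp a (fun u f =>
    ‖f * ((q ^ b * (q * (q - 1)) : ℝ) : ℂ) + u * ((q ^ b * (q - 1) : ℝ) : ℂ)‖
    + ((q : ℝ) - 1) * ‖f * ((-(q ^ b * q) : ℝ) : ℂ) + u * ((q ^ b * (q - 1) : ℝ) : ℂ)‖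
    + ((q : ℝ) ^ 2 - q) * ‖f * (0 : ℝ) + u * ((-(q ^ b) : ℝ) : ℂ)‖) (by simp)]
  simp only [← Complex.ofReal_mul, ← Complex.ofReal_add, Complex.norm_real, Real.norm_eq_abs]
  set x : ℝ := (p : ℝ) ^ a
  set y : ℝ := (q : ℝ) ^ b
  have hx : 0 ≤ x := by positivity
  have hy : 0 ≤ y := by positivity
  have hp1 : (0 : ℝ) ≤ p - 1 := by linarith
  have hq1 : (0 : ℝ) ≤ q - 1 := by linarith
  have hp0 : (0 : ℝ) ≤ p := by linarith
  have hq0 : (0 : ℝ) ≤ q := by linarith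
  have hm : (0 : ℝ) ≤ (p - 1) * (q - 1) - 1 := by nlinarith
  have hs : (0 : ℝ) ≤ p + q := by linarith
  -- `e1` to `e9` run over the orders (1, p, p²) of ψ and, within each, (1, q, q²) of χ.
  have e1 : x * ((p : ℝ) - 1) * (y * (q * (q - 1))) + x * (p * (p - 1)) * (y * (q - 1)) =
    x * y * ((p - 1) * (q - 1) * (p + q)) := by ring
  have e2 : x * ((p : ℝ) - 1) * (-(y * q)) + x * (p * (p - 1)) * (y * (q - 1)) =
    x * y * ((p - 1) * ((p - 1) * (q - 1) - 1)) := by ring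
  have e3 : x * ((p : ℝ) - 1) * 0 + x * (p * (p - 1)) * -y = -(x * y * (p * (p - 1))) := by ring
  have e4 : x * ((p : ℝ) - 1) * (y * (q * (q - 1))) + -(x * p) * (y * (q - 1)) =
    x * y * ((q - 1) * ((p - 1) * (q - 1) - 1)) := by ring
  have e5 : x * ((p : ℝ) - 1) * (-(y * q)) + -(x * p) * (y * (q - 1)) =
    -(x * y * ((p - 1) * q + p * (q - 1))) := by ring
  have e6 : x * ((p : ℝ) - 1) * 0 + -(x * p) * -y = x * y * p := by ring
  have e7 : -x * (y * ((q : ℝ) * (q - 1))) + 0 * (y * (q - 1)) = -(x * y * (q * (q - 1))) := by ring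
  have e8 : -x * (-(y * (q : ℝ))) + 0 * (y * (q - 1)) = x * y * q := by ring
  have e9 : -x * 0 + 0 * -y = 0 := by ring
  have h5 : (0 : ℝ) ≤ (p - 1) * q + p * (q - 1) := by positivity
  rw [e1, e2, e3, e4, e5, e6, e7, e8, e9]
  simp only [abs_neg, abs_mul, abs_zero, abs_of_nonneg hx, abs_of_nonneg hy, abs_of_nonneg hp1,
    abs_of_nonneg hq1, abs_of_nonneg hp0, abs_of_nonneg hq0, abs_of_nonneg hm, abs_of_nonneg hs,
    abs_of_nonneg h5]
  ring

end PairSum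

/-! ### Assembly of the energy formula -/

theorem energy_eq_pairSum_mul {p q P Q m : ℕ} [NeZero P] [NeZero Q] [NeZero m]
    (hPQ : P.Coprime (Q * m)) (hQm : Q.Coprime m) (hp : p ∣ P) (hq : q ∣ Q) (hp1 : p ≠ 1)
    (hq1 : q ≠ 1) :
    (integralCirculantGraph (P * (Q * m)) {p, q}).energy =
      pairSum p q P Q * (2 ^ m.primeFactors.card * (m.totient : ℝ)) := by
  have hcop : p.Coprime q := Nat.Coprime.of_dvd hp (hq.mul_right m) hPQ
  have hne : p ≠ q := by
    rintro rfl
    exact hp1 ((Nat.coprime_self p).1 hcop)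
  have hpn : p ≠ P * (Q * m) := by
    rintro h
    exact hq1 (hcop.symm.eq_one_of_dvd (h ▸ (hq.mul_right m).mul_left P))
  have hqn : q ≠ P * (Q * m) := by
    rintro h
    exact hp1 (hcop.eq_one_of_dvd (h ▸ hp.mul_right _))
  rw [energy_integralCirculantGraph_pair hpn hqn hne, AddChar.sum_zmodMul hPQ,
    ← sum_norm_gcdSum_one, pairSum, Finset.sum_mul]
  refine Finset.sum_congr rfl fun ψ _ => ?_
  rw [AddChar.sum_zmodMul hQm, Finset.sum_mul_sum]
  refine Finset.sum_congr rfl fun χ _ => Finset.sum_congr rfl fun ω _ => ?_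
  have h1 := gcdSum_mul hPQ hp (one_dvd (Q * m)) ψ (χ.zmodMul ω)
  have h2 := gcdSum_mul hPQ (one_dvd P) (hq.mul_right m) ψ (χ.zmodMul ω)
  have h3 := gcdSum_mul hQm (one_dvd Q) (one_dvd m) χ ω
  have h4 := gcdSum_mul hQm hq (one_dvd m) χ ω
  rw [mul_one] at h1 h3 h4
  rw [one_mul] at h2
  rw [h1, h2, h3, h4, ← norm_mul]
  congr 1
  ring

theorem Nat.exists_eq_prime_pow_succ_mul {n r : ℕ} (hr : r.Prime) (hn : n ≠ 0) (h : r ∣ n) :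
    ∃ a m, n = r ^ (a + 1) * m ∧ ¬ r ∣ m := by
  obtain ⟨a, m, hm, rfl⟩ := Nat.exists_eq_pow_mul_and_not_dvd hn r hr.ne_one
  rcases a with _ | a
  · exact (hm (by simpa using h)).elim
  · exact ⟨a, m, rfl, hm⟩

theorem Nat.Prime.sq_dvd_pow_mul_iff {r : ℕ} (hr : r.Prime) {a m : ℕ} (hm : ¬ r ∣ m) :
    r ^ 2 ∣ r ^ (a + 1) * m ↔ a ≠ 0 := by
  constructor
  · rintro h rfl
    rw [pow_two, zero_add, pow_one] at h
    exact hm (Nat.dvd_of_mul_dvd_mul_left hr.pos h)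
  · intro ha
    exact (pow_dvd_pow r (by omega)).mul_right m

theorem mainTheorem4 (n : ℕ) [NeZero n] (hn : 4 ≤ n) (p q k : ℕ)
    (hp : p.Prime) (hq : q.Prime) (hpq : p < q) (hpn : p ∣ n) (hqn : q ∣ n)
    (hk : k = n.primeFactors.card) :
    (¬ p ^ 2 ∣ n → ¬ q ^ 2 ∣ n →
      (integralCirculantGraph n {p, q}).energy = 2 ^ k * (Nat.totient n : ℝ)) ∧
    (p = 2 → ¬ p ^ 2 ∣ n → q ^ 2 ∣ n →
      (integralCirculantGraph n {p, q}).energy = 3 * 2 ^ (k - 1) * (Nat.totient n : ℝ)) ∧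
    (p ≠ 2 → ¬ p ^ 2 ∣ n → q ^ 2 ∣ n →
      (integralCirculantGraph n {p, q}).energy =
        2 ^ (k - 1) * (2 * (Nat.totient n : ℝ)
          + (Nat.totient (n / q) : ℝ) * (Nat.totient q : ℝ))) ∧
    (p ^ 2 ∣ n → ¬ q ^ 2 ∣ n →
      (integralCirculantGraph n {p, q}).energy =
        2 ^ (k - 1) * (2 * (Nat.totient n : ℝ)
          + (Nat.totient (n / p) : ℝ) * (Nat.totient p : ℝ))) ∧
    (p ^ 2 ∣ n → q ^ 2 ∣ n →
      (integralCirculantGraph n {p, q}).energy =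
        2 ^ (k - 1) * (2 * (Nat.totient n : ℝ)
          + (Nat.totient (n / p) : ℝ) * (Nat.totient p : ℝ)
          + (Nat.totient (n / q) : ℝ) * (Nat.totient q : ℝ))) := by
  have hpq' : p.Coprime q := (Nat.coprime_primes hp hq).2 hpq.ne
  obtain ⟨a, m', rfl, hpm'⟩ := Nat.exists_eq_prime_pow_succ_mul hp (NeZero.ne n) hpn
  have hm'0 : m' ≠ 0 := fun h => hpm' (h ▸ dvd_zero p)
  have hqm' : q ∣ m' := (hpq'.symm.pow_right _).dvd_of_dvd_mul_left hqn
  obtain ⟨b, m, rfl, hqm⟩ := Nat.exists_eq_prime_pow_succ_mul hq hm'0 hqm'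
  have hm0 : m ≠ 0 := fun h => hqm (h ▸ dvd_zero q)
  have : NeZero m := ⟨hm0⟩
  have : NeZero p := ⟨hp.ne_zero⟩
  have : NeZero q := ⟨hq.ne_zero⟩
  have hPm : ∀ c, (p ^ c).Coprime (q ^ (b + 1) * m) := fun c =>
    Nat.Coprime.pow_left c ((hp.coprime_iff_not_dvd).2 hpm')
  have hQm : ∀ c, (q ^ c).Coprime m := fun c =>
    Nat.Coprime.pow_left c ((hq.coprime_iff_not_dvd).2 hqm)
  -- The exponents are left free because φ(n/p) and φ(n/q) also occur.
  have hPm' : ∀ c d, (p ^ c).Coprime (q ^ d * m) := fun c d =>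
    Nat.Coprime.mul_right (hpq'.pow c d) ((hPm c).coprime_mul_left_right)
  have hφ : ∀ c d, ((p ^ c * (q ^ d * m)).totient : ℝ) =
      (p ^ c).totient * ((q ^ d).totient * m.totient) := fun c d => by
    rw [Nat.totient_mul (hPm' c d), Nat.totient_mul (hQm d)]
    push_cast
    rfl
  have hφp : ∀ c, ((p ^ (c + 1)).totient : ℝ) = p ^ c * (p - 1) := fun c => by
    rw [Nat.totient_prime_pow_succ hp, Nat.cast_mul, Nat.cast_sub hp.one_le, Nat.cast_pow,
      Nat.cast_one]
  have hφq : ∀ c, ((q ^ (c + 1)).totient : ℝ) = q ^ c * (q - 1) := fun c => by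
    rw [Nat.totient_prime_pow_succ hq, Nat.cast_mul, Nat.cast_sub hq.one_le, Nat.cast_pow,
      Nat.cast_one]
  have hφp1 : (p.totient : ℝ) = p - 1 := by simpa using hφp 0
  have hφq1 : (q.totient : ℝ) = q - 1 := by simpa using hφq 0
  have hk' : k = m.primeFactors.card + 2 := by
    rw [hk, (hPm _).primeFactors_mul, (hQm _).primeFactors_mul,
      Nat.primeFactors_prime_pow (Nat.succ_ne_zero _) hp,
      Nat.primeFactors_prime_pow (Nat.succ_ne_zero _) hq, Finset.card_union_of_disjoint,
      Finset.card_union_of_disjoint]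
    · simp only [Finset.card_singleton]
      omega
    · simp [hqm]
    · simp only [Finset.disjoint_singleton_left, Finset.mem_union, Finset.mem_singleton,
        Nat.mem_primeFactors, not_or]
      exact ⟨hpq.ne, fun h => hpm' (h.2.1.mul_left _)⟩
  have hdp : p ^ (a + 1) * (q ^ (b + 1) * m) / p = p ^ a * (q ^ (b + 1) * m) := by
    rw [pow_succ', mul_assoc, Nat.mul_div_cancel_left _ hp.pos]
  have hdq : p ^ (a + 1) * (q ^ (b + 1) * m) / q = p ^ (a + 1) * (q ^ b * m) := by
    rw [pow_succ' q, mul_assoc q, Nat.mul_left_comm, Nat.mul_div_cancel_left _ hq.pos]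
  have hp_sq := hp.sq_dvd_pow_mul_iff (a := a) hpm'
  have hq_sq : q ^ 2 ∣ p ^ (a + 1) * (q ^ (b + 1) * m) ↔ b ≠ 0 := by
    rw [← hq.sq_dvd_pow_mul_iff (a := b) hqm]
    exact ⟨fun h => (hpq'.symm.pow 2 (a + 1)).dvd_of_dvd_mul_left h, fun h => h.mul_left _⟩
  have hE := energy_eq_pairSum_mul (hPm (a + 1)) (hQm (b + 1)) (dvd_pow_self p a.succ_ne_zero)
    (dvd_pow_self q b.succ_ne_zero) hp.ne_one hq.ne_one
  have hk1 : k - 1 = m.primeFactors.card + 1 := by omega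
  rw [hp_sq, hq_sq, hdp, hdq, hE, hk1, hk']
  have hq3 : 3 ≤ q := hp.two_le.trans_lt hpq
  simp only [not_not]
  refine ⟨?_, ?_, ?_, ?_, ?_⟩
  · rintro rfl rfl
    rw [pairSum_prime_prime hp hq, hφ, hφp, hφq]
    ring
  · rintro rfl rfl hb
    obtain ⟨b, rfl⟩ := Nat.exists_eq_succ_of_ne_zero hb
    rw [pairSum_two_prime_pow hq, hφ, hφp, hφq]
    push_cast
    ring
  · rintro hp2 rfl hb
    obtain ⟨b, rfl⟩ := Nat.exists_eq_succ_of_ne_zero hb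
    rw [pairSum_odd_prime_prime_pow hp (by have := hp.two_le; omega) hq, hφ, hφ, hφp, hφq, hφq,
      hφq1]
    ring
  · rintro ha rfl
    obtain ⟨a, rfl⟩ := Nat.exists_eq_succ_of_ne_zero ha
    -- Here q is the prime of exponent 1, and q ≥ 3, so no exceptional case arises.
    rw [pairSum_comm, pairSum_odd_prime_prime_pow hq hq3 hp, hφ, hφ, hφp, hφp, hφq, hφp1]
    ring
  · rintro ha hb
    obtain ⟨a, rfl⟩ := Nat.exists_eq_succ_of_ne_zero ha
    obtain ⟨b, rfl⟩ := Nat.exists_eq_succ_of_ne_zero hb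
    rw [pairSum_prime_pow_prime_pow hp hq hpq, hφ, hφ, hφ, hφp, hφp, hφq, hφq, hφp1, hφq1]
    ring
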